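/- Fix standard bases of $\mathbb{C}^{d_A}$ and $\mathbb{C}^{d_B}$. The support of $|\psi\rangle\in\mathbb{C}^{d_A}\otimes\mathbb{C}^{d_B}$ is the set of cells $(r,c)$ of the grid $[d_A]\times[d_B]$ with $\langle r,c|\psi\rangle\neq 0$; the support of a product state $|\alpha\rangle|\beta\rangle$ is a product set $R\times C$, called the tile induced by the state. A set of orthonormal product states induces a tiling if the tiles induced by any two of its states are identical or disjoint. The tiling is of domino type if every tile has area $1$ or $2$. Its row graph has vertex set $[d_A]$, and $r\neq r'$ are adjacent iff for some column $c$ the cells $(r,c)$ and $(r',c)$ belong to the same tile; its column graph, on $[d_B]$, is defined in the same way. The tiling is irreducible if both graphs are connected, and its diameter is the maximum of the diameters of the two graphs. **Corollary.** Let $d_A,d_B\geq 3$ and let $S$ be an orthonormal basis of $\mathbb{C}^{d_A}\otimes\mathbb{C}^{d_B}$ that consists of product states and induces an irreducible domino-type tiling of diameter $D$. Suppose that, as for the domino states, every state of $S$ that induces a tile of area $2$ is an equal-weight superposition of the two cells of its tile (that is, up to a global phase it equals $(|p\rangle+z|q\rangle)/\sqrt2$ with $|z|=1$, where $p,q\in[d_A]\times[d_B]$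 are the two cells; for example $|r\rangle(|c\rangle\pm|c'\rangle)/\sqrt2$ or $(|r\rangle\pm|r'\rangle)|c\rangle/\sqrt2$). Then every measurement that is implemented by a finite two-party LOCC protocol and is used to identify a state drawn uniformly at random from $S$ errs with probability $$p_{\mathrm{error}}\;\geq\;\frac{1}{216\,D^2\,(d_A d_B)^5}.$$ -/

import Mathlib

open scoped Matrix Kronecker

noncomputable section

/-! ## Two-party LOCC protocols

The joint space of `ℂ^{dA}` and `ℂ^{dB}` is `ℂ^{dA × dB}`, with the standard product basis indexed
by the cells of the grid `Fin dA × Fin dB`. -/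

/-- A finite two-party LOCC protocol with final outcomes in `ι`, as a tree, for parties that
currently hold the spaces `ℂ^{dA}` and `ℂ^{dB}`. At a leaf the protocol stops and announces an
outcome. At any other node one of the parties applies a non-destructive measurement
`M 0, …, M (k - 1)`, with an arbitrary finite output dimension `m`, and announces the result `i`;
the protocol continues with the subtree `next i`. -/
inductive LOCCProtocol (ι : Type*) : ℕ → ℕ → Type _
  | leaf {dA dB : ℕ} (out : ι) : LOCCProtocol ι dA dB
  | alice {dA dB : ℕ} (k m : ℕ) (M : Fin k → Matrix (Fin m) (Fin dA) ℂ)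
      (complete : ∑ i, (M i)ᴴ * M i = 1)
      (next : Fin k → LOCCProtocol ι m dB) : LOCCProtocol ι dA dB
  | bob {dA dB : ℕ} (k m : ℕ) (M : Fin k → Matrix (Fin m) (Fin dB) ℂ)
      (complete : ∑ i, (M i)ᴴ * M i = 1)
      (next : Fin k → LOCCProtocol ι dA m) : LOCCProtocol ι dA dB

/-- The sum of `(A_mᴴ A_m) ⊗ (B_mᴴ B_m)` over all leaves `m` of the given (sub)tree that announce
the outcome `j`, where `A_m ⊗ B_m` is the total measurement operator at the leaf `m`, provided
that `A ⊗ B` is the one at the root of the subtree. -/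
def LOCCProtocol.elementFrom {ι : Type*} [DecidableEq ι] {dA dB : ℕ} :
    {a b : ℕ} → LOCCProtocol ι a b → Matrix (Fin a) (Fin dA) ℂ → Matrix (Fin b) (Fin dB) ℂ →
      ι → Matrix (Fin dA × Fin dB) (Fin dA × Fin dB) ℂ
  | _, _, .leaf out, A, B, j => if out = j then (Aᴴ * A) ⊗ₖ (Bᴴ * B) else 0
  | _, _, .alice _ _ M _ next, A, B, j => ∑ i, (next i).elementFrom (M i * A) B j
  | _, _, .bob _ _ M _ next, A, B, j => ∑ i, (next i).elementFrom A (M i * B) j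

/-- The measurement implemented by an LOCC protocol: its POVM element for the outcome `j`. -/
def LOCCProtocol.povm {ι : Type*} [DecidableEq ι] {dA dB : ℕ} (P : LOCCProtocol ι dA dB) (j : ι) :
    Matrix (Fin dA × Fin dB) (Fin dA × Fin dB) ℂ :=
  P.elementFrom 1 1 j

/-! ## State discrimination -/

/-- `⟨v| E |v⟩`, the probability of the outcome with POVM element `E` on the pure state `v`. -/
def outcomeProb {κ : Type*} [Fintype κ] (E : Matrix κ κ ℂ) (v : EuclideanSpace ℂ κ) : ℝ :=
  (star (v : κ → ℂ) ⬝ᵥ (E *ᵥ (v : κ → ℂ))).re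

/-- The probability that the measurement `E` announces a wrong index when it is applied to the
state `ψ k`, with `k` drawn uniformly at random. -/
def errorProb {ι κ : Type*} [Fintype ι] [DecidableEq ι] [Fintype κ]
    (ψ : ι → EuclideanSpace ℂ κ) (E : ι → Matrix κ κ ℂ) : ℝ :=
  ∑ k, (1 / (Fintype.card ι : ℝ)) * ∑ j ∈ Finset.univ.erase k, outcomeProb (E j) (ψ k)

/-! ## Product states and the tilings they induce -/

/-- `v = α ⊗ β` for some `α` and `β`. -/
def IsProductState {dA dB : ℕ} (v : EuclideanSpace ℂ (Fin dA × Fin dB)) : Prop :=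
  ∃ (α : EuclideanSpace ℂ (Fin dA)) (β : EuclideanSpace ℂ (Fin dB)),
    ∀ p : Fin dA × Fin dB, v p = α p.1 * β p.2

/-- The support of a state, a set of cells of the grid (a tile if the state is a product state). -/
def stateSupport {dA dB : ℕ} (v : EuclideanSpace ℂ (Fin dA × Fin dB)) : Set (Fin dA × Fin dB) :=
  {p | v p ≠ 0}

/-- The set of the supports of the given states. -/
def inducedTiles {ι : Type*} {dA dB : ℕ} (ψ : ι → EuclideanSpace ℂ (Fin dA × Fin dB)) :
    Set (Set (Fin dA × Fin dB)) :=
  Set.range fun i => stateSupport (ψ i)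

/-- The given product states induce a tiling: any two tiles are identical or disjoint. -/
def InducesTiling {ι : Type*} {dA dB : ℕ} (ψ : ι → EuclideanSpace ℂ (Fin dA × Fin dB)) : Prop :=
  ∀ i j, stateSupport (ψ i) = stateSupport (ψ j) ∨
    Disjoint (stateSupport (ψ i)) (stateSupport (ψ j))

/-- Every tile has area 1 or 2. -/
def IsDominoType {dA dB : ℕ} (T : Set (Set (Fin dA × Fin dB))) : Prop :=
  ∀ t ∈ T, t.ncard = 1 ∨ t.ncard = 2

/-- Two rows are adjacent iff, in some column, their cells belong to the same tile. -/
def rowGraph {dA dB : ℕ} (T : Set (Set (Fin dA × Fin dB))) : SimpleGraph (Fin dA) where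
  Adj r r' := r ≠ r' ∧ ∃ t ∈ T, ∃ c, (r, c) ∈ t ∧ (r', c) ∈ t
  symm := ⟨fun _ _ ⟨h, t, ht, c, h₁, h₂⟩ => ⟨h.symm, t, ht, c, h₂, h₁⟩⟩
  loopless := ⟨fun _ h => h.1 rfl⟩

/-- Two columns are adjacent iff, in some row, their cells belong to the same tile. -/
def columnGraph {dA dB : ℕ} (T : Set (Set (Fin dA × Fin dB))) : SimpleGraph (Fin dB) where
  Adj c c' := c ≠ c' ∧ ∃ t ∈ T, ∃ r, (r, c) ∈ t ∧ (r, c') ∈ t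
  symm := ⟨fun _ _ ⟨h, t, ht, r, h₁, h₂⟩ => ⟨h.symm, t, ht, r, h₂, h₁⟩⟩
  loopless := ⟨fun _ h => h.1 rfl⟩

/-- The row graph and the column graph are both connected. -/
def IsIrreducibleTiling {dA dB : ℕ} (T : Set (Set (Fin dA × Fin dB))) : Prop :=
  (rowGraph T).Connected ∧ (columnGraph T).Connected

/-- The maximum of the diameters of the row graph and of the column graph. -/
def tilingDiameter {dA dB : ℕ} (T : Set (Set (Fin dA × Fin dB))) : ℕ :=
  max (rowGraph T).diam (columnGraph T).diam

/-- All nonzero amplitudes of the state have the same modulus. For a unit vector whose support is a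
tile `{p, q}` of area 2 this says that it is `(|p⟩ + z |q⟩) / √2` up to a global phase, with
`|z| = 1`; for a state whose support is a single cell it says nothing. -/
def IsBalanced {dA dB : ℕ} (v : EuclideanSpace ℂ (Fin dA × Fin dB)) : Prop :=
  ∀ p ∈ stateSupport v, ∀ q ∈ stateSupport v, ‖v p‖ = ‖v q‖

end

/-! Write `n = dA * dB`. At a node of the protocol the accumulated operator is `a ⊗ b`, and its
weight is its trace. Call it nearly uniform if no diagonal cell exceeds `1 / n + 1 / (2 n²)` of the
weight. The claim, proved by induction on the tree, is that below a nearly uniform node the total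
error is at least `φ = 1 / (216 D² n⁵)` times the weight. The root is nearly uniform with weight
`n`.

A nearly uniform leaf announces one state, which carries only a small part of the weight
(`le_totalError_single`). On the boundary, where some cell attains the threshold, every measurement
refining `a ⊗ b`, LOCC or not, obeys the bound (`le_totalError_of_boundary`). Indeed, a small error
forces small overlaps `⟨ψ i|G|ψ j⟩` (`norm_form_sq_le_totalError`). For the two states of a domino
this overlap controls the difference of the diagonal entries of `G` on its two cells
(`balanced_pair_norm_form`). Since both graphs are connected and the weights are products, all cells
are then too close to the average to attain the threshold (`grid_cell_lt`).

A child may jump across the boundary. The segment from parent to child still consists of product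
operators, since only one factor changes, and it meets the boundary. The mixture of the two
measurements at that point obeys the bound, so if the parent violated it, the child would satisfy
it. Then all children would satisfy it, and summing over them contradicts the violation at the
parent (`LOCCProtocol.le_totalError_elementFrom`). -/

/-! ### Product weights on a grid with connected graphs -/

theorem abs_sub_le_length_mul {V : Type*} {G : SimpleGraph V} {f : V → ℝ} {κ : ℝ}
    (h : ∀ u v, G.Adj u v → |f u - f v| ≤ κ) {u v : V} (p : G.Walk u v) :
    |f u - f v| ≤ p.length * κ := by
  induction p with
  | nil => simp
  | @cons u v w huv p ih =>
    calc |f u - f w| ≤ |f u - f v| + |f v - f w| := abs_sub_le _ _ _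
      _ ≤ κ + p.length * κ := add_le_add (h u v huv) ih
      _ = _ := by rw [SimpleGraph.Walk.length_cons]; push_cast; ring

theorem abs_sub_le_diam_mul {V : Type*} [Finite V] {G : SimpleGraph V} (hG : G.Connected)
    {D : ℕ} (hD : G.diam ≤ D) {f : V → ℝ} {κ : ℝ} (hκ : 0 ≤ κ)
    (h : ∀ u v, G.Adj u v → |f u - f v| ≤ κ) (u v : V) : |f u - f v| ≤ D * κ := by
  have := hG.nonempty
  obtain ⟨p, hp⟩ := hG.exists_walk_length_eq_dist u v
  have hle : G.dist u v ≤ G.diam :=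
    SimpleGraph.dist_le_diam (SimpleGraph.connected_iff_ediam_ne_top.mp hG)
  refine (abs_sub_le_length_mul h p).trans (mul_le_mul_of_nonneg_right ?_ hκ)
  exact_mod_cast hp ▸ hle.trans hD

/-- If the column weights vary little along the edges of a connected graph, a cell exceeds the
average over its row by little. -/
theorem card_mul_cell_le {α β : Type*} [Fintype β] {x : α → ℝ} {y : β → ℝ}
    (hx0 : ∀ r, 0 ≤ x r) (hx : ∀ r r', x r' ≤ 3 * x r) {H : SimpleGraph β} (hH : H.Connected)
    {D : ℕ} (hD : H.diam ≤ D) {κ : ℝ} (hκ : 0 ≤ κ)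
    (hadj : ∀ c c', H.Adj c c' → ∃ r, x r * |y c - y c'| ≤ κ) (r : α) (c : β) :
    Fintype.card β * (x r * y c) ≤ x r * ∑ c', y c' + Fintype.card β * (D * (3 * κ)) := by
  have h1 : ∀ c c', H.Adj c c' → |x r * y c - x r * y c'| ≤ 3 * κ := by
    intro c c' hc
    obtain ⟨r', hr'⟩ := hadj c c' hc
    rw [← mul_sub, abs_mul, abs_of_nonneg (hx0 r)]
    -- The edge is controlled only in the row `r'` of its domino; moving it to row `r` costs the
    -- factor 3.
    nlinarith [mul_le_mul_of_nonneg_right (hx r' r) (abs_nonneg (y c - y c'))]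
  have h2 := abs_sub_le_diam_mul hH hD (by positivity) h1
  have h3 : ∑ _c' : β, x r * y c ≤ ∑ c', (x r * y c' + D * (3 * κ)) :=
    Finset.sum_le_sum fun c' _ => by linarith [(abs_le.mp (h2 c c')).2]
  simpa [Finset.sum_add_distrib, Finset.mul_sum] using h3

/-- The upper bound on all cells yields a lower bound on each, so weights of rows and of columns
differ by a factor of at most 3. A cell then exceeds its row average, and a row average the overall
one, by at most `D * 3κ` each, which falls short of the margin `T / (2 n²)`. -/
theorem grid_cell_lt {α β : Type*} [Fintype α] [Fintype β] {x : α → ℝ} {y : β → ℝ}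
    (hx0 : ∀ r, 0 ≤ x r) (hy0 : ∀ c, 0 ≤ y c)
    {G : SimpleGraph α} {H : SimpleGraph β} (hG : G.Connected) (hH : H.Connected)
    {D : ℕ} (hD0 : 0 < D) (hGD : G.diam ≤ D) (hHD : H.diam ≤ D)
    {n T : ℝ} (hn : n = Fintype.card α * Fintype.card β) (hn9 : 9 ≤ n)
    (hT : T = (∑ r, x r) * ∑ c, y c) (hTpos : 0 < T)
    (hle : ∀ r c, x r * y c ≤ (1 / n + 1 / (2 * n ^ 2)) * T)
    (hcol : ∀ c c', H.Adj c c' → ∃ r, x r * |y c - y c'| ≤ 2 * (1 / (10 * D * n ^ 3)) * T)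
    (hrow : ∀ r r', G.Adj r r' → ∃ c, y c * |x r - x r'| ≤ 2 * (1 / (10 * D * n ^ 3)) * T)
    (r : α) (c : β) : x r * y c < (1 / n + 1 / (2 * n ^ 2)) * T := by
  classical
  have hnpos : 0 < n := by linarith
  have hDpos : (0 : ℝ) < D := by exact_mod_cast hD0
  -- The other `n - 1` cells leave at least `T / (2n) + T / (2n²)` for this one.
  have hmin : ∀ r c, 1 / (2 * n) * T ≤ x r * y c := by
    intro r c
    have h1 : ∑ q : α × β, x q.1 * y q.2 = T := by
      rw [hT, Finset.sum_mul_sum, Fintype.sum_prod_type]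
    rw [← Finset.add_sum_erase _ _ (Finset.mem_univ (r, c))] at h1
    have h2 : ∑ q ∈ Finset.univ.erase (r, c), x q.1 * y q.2 ≤
        (n - 1) * ((1 / n + 1 / (2 * n ^ 2)) * T) := by
      refine (Finset.sum_le_card_nsmul _ _ _ fun q _ => hle q.1 q.2).trans (le_of_eq ?_)
      rw [Finset.card_erase_of_mem (Finset.mem_univ _), Finset.card_univ, Fintype.card_prod,
        nsmul_eq_mul, Nat.cast_sub, hn]
      · push_cast; ring
      · have : (0 : ℝ) < (Fintype.card α * Fintype.card β : ℕ) := by push_cast; linarith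
        have : 0 < Fintype.card α * Fintype.card β := by exact_mod_cast this
        omega
    have h3 : T - (n - 1) * ((1 / n + 1 / (2 * n ^ 2)) * T) - 1 / (2 * n) * T
        = 1 / (2 * n ^ 2) * T := by
      field_simp; ring
    have h4 : 0 ≤ 1 / (2 * n ^ 2) * T := by positivity
    simp only at h1
    linarith
  have hM : (1 / n + 1 / (2 * n ^ 2)) ≤ 3 * (1 / (2 * n)) := by
    have : 3 * (1 / (2 * n)) - (1 / n + 1 / (2 * n ^ 2)) = (n - 1) / (2 * n ^ 2) := by
      field_simp; ring
    have : 0 ≤ (n - 1) / (2 * n ^ 2) := div_nonneg (by linarith) (by positivity)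
    linarith
  have hratio : ∀ r c r' c', x r' * y c' ≤ 3 * (x r * y c) := fun r c r' c' => by
    nlinarith [hle r' c', hmin r c, mul_le_mul_of_nonneg_right hM hTpos.le]
  have hpos : ∀ r c, 0 < x r * y c := fun r c =>
    lt_of_lt_of_le (by positivity) (hmin r c)
  have hx : ∀ r r', x r' ≤ 3 * x r := fun r r' => by
    have hy : 0 < y c := pos_of_mul_pos_right (hpos r c) (hx0 r)
    exact le_of_mul_le_mul_right (by linarith [hratio r c r' c]) hy
  have hy : ∀ c c', y c' ≤ 3 * y c := fun c c' => by
    have hx : 0 < x r := pos_of_mul_pos_left (hpos r c) (hy0 c)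
    exact le_of_mul_le_mul_left (by linarith [hratio r c r c']) hx
  set κ := 2 * (1 / (10 * D * n ^ 3)) * T with hκ
  have hκ0 : 0 ≤ κ := by positivity
  have h1 := card_mul_cell_le hx0 hx hH hHD hκ0 hcol r c
  have h2 := fun c => card_mul_cell_le hy0 hy hG hGD hκ0 hrow c r
  have h3 := Finset.sum_le_sum fun c (_ : c ∈ Finset.univ) => h2 c
  simp only [Finset.sum_add_distrib, ← Finset.mul_sum, ← Finset.sum_mul, Finset.sum_const,
    Finset.card_univ, nsmul_eq_mul] at h3
  have hA : (0 : ℝ) ≤ Fintype.card α := Nat.cast_nonneg _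
  have h4 : n * (x r * y c) ≤ T + 2 * (n * (D * (3 * κ))) := by
    rw [hn, hT]
    nlinarith [mul_le_mul_of_nonneg_left h1 hA]
  -- The left side is `(6/5) T / n²`, so `n > 12/5` is enough.
  have h5 : 2 * (n * (D * (3 * κ))) < 1 / (2 * n) * T := by
    have : 1 / (2 * n) * T - 2 * (n * (D * (3 * κ))) = (n - 12 / 5) / (2 * n ^ 2) * T := by
      rw [hκ]; field_simp; ring
    have : 0 < (n - 12 / 5) / (2 * n ^ 2) * T :=
      mul_pos (div_pos (by linarith) (by positivity)) hTpos
    linarith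
  have h6 : n * ((1 / n + 1 / (2 * n ^ 2)) * T) = T + 1 / (2 * n) * T := by
    field_simp
  exact lt_of_mul_lt_mul_left (by linarith) hnpos.le

/-- Going linearly from a point at which all functions are nonpositive to one at which some function
is positive, one meets a point at which the maximum of the functions vanishes. -/
theorem exists_crossing {K : Type*} [Fintype K] {u v : K → ℝ} (hu : ∀ k, u k ≤ 0)
    (hv : ∃ k, 0 < v k) : ∃ t : ℝ, 0 ≤ t ∧ t ≤ 1 ∧ (∀ k, (1 - t) * u k + t * v k ≤ 0) ∧
      ∃ k, (1 - t) * u k + t * v k = 0 := by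
  obtain ⟨k₀, hk₀⟩ := hv
  have hne : (Finset.univ : Finset K).Nonempty := ⟨k₀, Finset.mem_univ _⟩
  let f : ℝ → ℝ := fun t => Finset.univ.sup' hne fun k => (1 - t) * u k + t * v k
  have hf : Continuous f :=
    Continuous.finset_sup'_apply hne fun k _ => by fun_prop
  have h0 : f 0 ≤ 0 := Finset.sup'_le _ _ fun k _ => by simpa using hu k
  have h1 : 0 ≤ f 1 := by
    refine le_trans ?_ (Finset.le_sup' (fun k => (1 - (1 : ℝ)) * u k + 1 * v k)
      (Finset.mem_univ k₀))
    simpa using hk₀.le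
  obtain ⟨t, ⟨ht0, ht1⟩, ht⟩ := intermediate_value_Icc zero_le_one hf.continuousOn ⟨h0, h1⟩
  refine ⟨t, ht0, ht1, fun k => ?_, ?_⟩
  · rw [← ht]
    exact Finset.le_sup' (fun k => (1 - t) * u k + t * v k) (Finset.mem_univ k)
  · obtain ⟨k, _, hk⟩ := Finset.exists_mem_eq_sup' hne fun k => (1 - t) * u k + t * v k
    exact ⟨k, hk ▸ ht⟩

/-! ### Quadratic forms of measurement operators -/

section Forms

open scoped ComplexOrder MatrixOrder

variable {κ : Type*} [Fintype κ]

theorem outcomeProb_add (E F : Matrix κ κ ℂ) (v : EuclideanSpace ℂ κ) :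
    outcomeProb (E + F) v = outcomeProb E v + outcomeProb F v := by
  simp [outcomeProb, Matrix.add_mulVec, dotProduct_add]

theorem outcomeProb_zero (v : EuclideanSpace ℂ κ) : outcomeProb 0 v = 0 := by
  simp [outcomeProb]

theorem outcomeProb_smul (c : ℝ) (E : Matrix κ κ ℂ) (v : EuclideanSpace ℂ κ) :
    outcomeProb (c • E) v = c * outcomeProb E v := by
  simp [outcomeProb, Matrix.smul_mulVec, dotProduct_smul]

theorem outcomeProb_sum {α : Type*} (s : Finset α) (E : α → Matrix κ κ ℂ)
    (v : EuclideanSpace ℂ κ) :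
    outcomeProb (∑ i ∈ s, E i) v = ∑ i ∈ s, outcomeProb (E i) v := by
  classical
  induction s using Finset.induction_on with
  | empty => simp [outcomeProb_zero]
  | insert a s ha ih => rw [Finset.sum_insert ha, Finset.sum_insert ha, outcomeProb_add, ih]

theorem Matrix.PosSemidef.outcomeProb_nonneg {E : Matrix κ κ ℂ} (hE : E.PosSemidef)
    (v : EuclideanSpace ℂ κ) : 0 ≤ outcomeProb E v :=
  hE.re_dotProduct_nonneg (v : κ → ℂ)

theorem Matrix.PosSemidef.norm_form_sq_le {E : Matrix κ κ ℂ} (hE : E.PosSemidef)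
    (u v : EuclideanSpace ℂ κ) :
    ‖star (u : κ → ℂ) ⬝ᵥ (E *ᵥ (v : κ → ℂ))‖ ^ 2 ≤ outcomeProb E u * outcomeProb E v := by
  classical
  obtain ⟨B, rfl⟩ := CStarAlgebra.nonneg_iff_eq_star_mul_self.mp hE.nonneg
  have key : ∀ u v : EuclideanSpace ℂ κ, star (u : κ → ℂ) ⬝ᵥ ((Bᴴ * B) *ᵥ (v : κ → ℂ)) =
      inner ℂ (WithLp.toLp 2 (B *ᵥ (u : κ → ℂ)) : EuclideanSpace ℂ κ)
        (WithLp.toLp 2 (B *ᵥ (v : κ → ℂ))) := by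
    intro u v
    rw [EuclideanSpace.inner_eq_star_dotProduct, ← Matrix.mulVec_mulVec,
      Matrix.dotProduct_mulVec, ← Matrix.star_mulVec, dotProduct_comm]
  have h2 : ∀ u : EuclideanSpace ℂ κ, outcomeProb (Bᴴ * B) u =
      ‖(WithLp.toLp 2 (B *ᵥ (u : κ → ℂ)) : EuclideanSpace ℂ κ)‖ ^ 2 := by
    intro u
    rw [outcomeProb, key, inner_self_eq_norm_sq_to_K]
    norm_cast
  rw [Matrix.star_eq_conjTranspose, key, h2, h2, ← mul_pow]
  exact pow_le_pow_left₀ (norm_nonneg _) (norm_inner_le_norm _ _) 2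

/-- The values of `outcomeProb` on an orthonormal basis add up to the trace. -/
theorem sum_outcomeProb {ι : Type*} [Fintype ι] [DecidableEq κ]
    (ψ : OrthonormalBasis ι ℂ (EuclideanSpace ℂ κ)) (G : Matrix κ κ ℂ) :
    ∑ k, outcomeProb G (ψ k) = (G.trace).re := by
  have h := LinearMap.trace_eq_sum_inner (Matrix.toEuclideanLin G) ψ
  have h2 : LinearMap.trace ℂ _ (Matrix.toEuclideanLin G) = G.trace := by
    rw [Matrix.toEuclideanLin_eq_toLin_orthonormal, Matrix.trace_toLin_eq]
  rw [← h2, h, Complex.re_sum]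
  refine Finset.sum_congr rfl fun k _ => ?_
  rw [EuclideanSpace.inner_eq_star_dotProduct, dotProduct_comm]
  rfl

end Forms

/-! ### Total error and overlaps -/

section Errors

open scoped ComplexOrder

variable {ι κ : Type*} [Fintype ι] [DecidableEq ι] [Fintype κ]

/-- The total weight of wrong announcements, summed over the states. -/
noncomputable def totalError (ψ : ι → EuclideanSpace ℂ κ) (E : ι → Matrix κ κ ℂ) : ℝ :=
  ∑ k, ∑ j ∈ Finset.univ.erase k, outcomeProb (E j) (ψ k)

theorem errorProb_eq_totalError (ψ : ι → EuclideanSpace ℂ κ) (E : ι → Matrix κ κ ℂ) :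
    errorProb ψ E = 1 / (Fintype.card ι : ℝ) * totalError ψ E := by
  rw [errorProb, totalError, Finset.mul_sum]

theorem totalError_add (ψ : ι → EuclideanSpace ℂ κ) (E F : ι → Matrix κ κ ℂ) :
    totalError ψ (E + F) = totalError ψ E + totalError ψ F := by
  simp [totalError, outcomeProb_add, Finset.sum_add_distrib]

theorem totalError_smul (ψ : ι → EuclideanSpace ℂ κ) (c : ℝ) (E : ι → Matrix κ κ ℂ) :
    totalError ψ (c • E) = c * totalError ψ E := by
  simp only [totalError, Pi.smul_apply, outcomeProb_smul, Finset.mul_sum]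

theorem totalError_sum {α : Type*} (s : Finset α) (ψ : ι → EuclideanSpace ℂ κ)
    (E : α → ι → Matrix κ κ ℂ) :
    totalError ψ (fun j => ∑ i ∈ s, E i j) = ∑ i ∈ s, totalError ψ (E i) := by
  simp only [totalError, outcomeProb_sum]
  rw [Finset.sum_comm]
  refine Finset.sum_congr rfl fun k _ => Finset.sum_comm

theorem totalError_nonneg (ψ : ι → EuclideanSpace ℂ κ) {E : ι → Matrix κ κ ℂ}
    (hE : ∀ j, (E j).PosSemidef) : 0 ≤ totalError ψ E :=
  Finset.sum_nonneg fun k _ => Finset.sum_nonneg fun j _ => (hE j).outcomeProb_nonneg (ψ k)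

/-- A measurement that refines `G` confuses two states between which `G` has a large overlap. -/
theorem norm_form_sq_le_totalError (ψ : ι → EuclideanSpace ℂ κ) {E : ι → Matrix κ κ ℂ}
    (hE : ∀ j, (E j).PosSemidef) {G : Matrix κ κ ℂ} (hG : ∑ j, E j = G) {i j : ι} (hij : i ≠ j) :
    ‖star (ψ i : κ → ℂ) ⬝ᵥ (G *ᵥ (ψ j : κ → ℂ))‖ ^ 2 ≤
      (outcomeProb G (ψ i) + outcomeProb G (ψ j)) * totalError ψ E := by
  -- Merging all outcomes other than `i` leaves a two-outcome test: `F` is wrong on `ψ i`, and `E i`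
  -- is wrong on `ψ j`. Cauchy–Schwarz for each of the two operators thus contains one error factor.
  set F := ∑ l ∈ Finset.univ.erase i, E l with hF
  have hFpos : F.PosSemidef := Matrix.posSemidef_sum _ fun l _ => hE l
  have hsplit : G = E i + F := by
    rw [← hG, hF, Finset.add_sum_erase _ _ (Finset.mem_univ i)]
  have herr : outcomeProb F (ψ i) + outcomeProb (E i) (ψ j) ≤ totalError ψ E := by
    have hnn : ∀ k, 0 ≤ ∑ l ∈ Finset.univ.erase k, outcomeProb (E l) (ψ k) := fun k =>
      Finset.sum_nonneg fun l _ => (hE l).outcomeProb_nonneg (ψ k)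
    calc outcomeProb F (ψ i) + outcomeProb (E i) (ψ j)
        ≤ ∑ l ∈ Finset.univ.erase i, outcomeProb (E l) (ψ i) +
          ∑ l ∈ Finset.univ.erase j, outcomeProb (E l) (ψ j) := by
          rw [hF, outcomeProb_sum]
          gcongr
          exact Finset.single_le_sum (f := fun l => outcomeProb (E l) (ψ j))
            (fun l _ => (hE l).outcomeProb_nonneg (ψ j))
            (Finset.mem_erase.mpr ⟨hij, Finset.mem_univ i⟩)
      _ = ∑ k ∈ {i, j}, ∑ l ∈ Finset.univ.erase k, outcomeProb (E l) (ψ k) :=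
          (Finset.sum_pair (f := fun k => ∑ l ∈ Finset.univ.erase k, outcomeProb (E l) (ψ k)) hij).symm
      _ ≤ totalError ψ E :=
          Finset.sum_le_sum_of_subset_of_nonneg (Finset.subset_univ _) fun k _ _ => hnn k
  have h1 := (hE i).norm_form_sq_le (ψ i) (ψ j)
  have h2 := hFpos.norm_form_sq_le (ψ i) (ψ j)
  have p1 := (hE i).outcomeProb_nonneg (ψ i)
  have p2 := (hE i).outcomeProb_nonneg (ψ j)
  have p3 := hFpos.outcomeProb_nonneg (ψ i)
  have p4 := hFpos.outcomeProb_nonneg (ψ j)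
  have htri : ‖star (ψ i : κ → ℂ) ⬝ᵥ (G *ᵥ (ψ j : κ → ℂ))‖ ≤
      ‖star (ψ i : κ → ℂ) ⬝ᵥ (E i *ᵥ (ψ j : κ → ℂ))‖ +
      ‖star (ψ i : κ → ℂ) ⬝ᵥ (F *ᵥ (ψ j : κ → ℂ))‖ := by
    rw [hsplit, Matrix.add_mulVec, dotProduct_add]
    exact norm_add_le _ _
  rw [hsplit, outcomeProb_add, outcomeProb_add, ← hsplit]
  set g₁ := ‖star (ψ i : κ → ℂ) ⬝ᵥ (E i *ᵥ (ψ j : κ → ℂ))‖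
  set g₂ := ‖star (ψ i : κ → ℂ) ⬝ᵥ (F *ᵥ (ψ j : κ → ℂ))‖
  have n1 : 0 ≤ g₁ := norm_nonneg _
  have n2 : 0 ≤ g₂ := norm_nonneg _
  set x := outcomeProb (E i) (ψ i)
  set y := outcomeProb F (ψ j)
  set e := outcomeProb F (ψ i)
  set e' := outcomeProb (E i) (ψ j)
  -- AM–GM after regrouping `(x e') (e y)` as `(x e) (y e')`.
  have h3 : 2 * (g₁ * g₂) ≤ x * e + y * e' := by
    refine abs_le_of_sq_le_sq' ?_ (by positivity) |>.2
    have : (g₁ * g₂) ^ 2 ≤ (x * e') * (e * y) := by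
      rw [mul_pow]; exact mul_le_mul h1 h2 (by positivity) (by positivity)
    nlinarith [sq_nonneg (x * e - y * e')]
  calc _ ≤ (g₁ + g₂) ^ 2 := pow_le_pow_left₀ (norm_nonneg _) htri 2
    _ ≤ (x + y) * (e + e') := by nlinarith
    _ ≤ (x + e + (e' + y)) * (e + e') :=
        mul_le_mul_of_nonneg_right (by linarith) (by positivity)
    _ ≤ _ := mul_le_mul_of_nonneg_left herr (by positivity)

theorem totalError_single (ψ : ι → EuclideanSpace ℂ κ) (G : Matrix κ κ ℂ) (out : ι) :
    totalError ψ (fun j => if out = j then G else 0) =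
      ∑ k, outcomeProb G (ψ k) - outcomeProb G (ψ out) := by
  have h : ∀ k, ∑ j ∈ Finset.univ.erase k, outcomeProb (if out = j then G else 0) (ψ k) =
      if out = k then 0 else outcomeProb G (ψ k) := by
    intro k
    split_ifs with hk
    · refine Finset.sum_eq_zero fun j hj => ?_
      rw [if_neg (by rw [hk]; exact (Finset.ne_of_mem_erase hj).symm), outcomeProb_zero]
    · rw [Finset.sum_eq_single out]
      · simp
      · intro j _ hj
        rw [if_neg hj.symm, outcomeProb_zero]
      · intro ho
        exact absurd (Finset.mem_erase.mpr ⟨hk, Finset.mem_univ _⟩) ho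
  rw [totalError, Finset.sum_congr rfl fun k _ => h k,
    ← Finset.add_sum_erase _ _ (Finset.mem_univ out),
    ← Finset.add_sum_erase _ (fun k => outcomeProb G (ψ k)) (Finset.mem_univ out)]
  simp only [if_true, zero_add, add_sub_cancel_left]
  exact Finset.sum_congr rfl fun k hk => if_neg (Finset.ne_of_mem_erase hk).symm

end Errors

/-! ### The two balanced states on a pair of cells -/

section Dominoes

variable {κ : Type*} [Fintype κ] [DecidableEq κ]

theorem form_eq_of_support_pair (G : Matrix κ κ ℂ) {u v : κ → ℂ} {p q : κ} (hpq : p ≠ q)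
    (hu : ∀ s, s ≠ p → s ≠ q → u s = 0) (hv : ∀ s, s ≠ p → s ≠ q → v s = 0) :
    star u ⬝ᵥ (G *ᵥ v) = star (u p) * (G p p * v p + G p q * v q) +
      star (u q) * (G q p * v p + G q q * v q) := by
  have hsum : ∀ f : κ → ℂ, (∀ s, s ≠ p → s ≠ q → f s = 0) → ∑ s, f s = f p + f q := by
    intro f hf
    rw [← Finset.sum_pair hpq]
    refine (Finset.sum_subset (Finset.subset_univ _) fun s _ hs => ?_).symm
    simp only [Finset.mem_insert, Finset.mem_singleton, not_or] at hs
    exact hf s hs.1 hs.2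
  rw [dotProduct, hsum _ fun s h1 h2 => by simp [hu s h1 h2]]
  simp only [Matrix.mulVec, dotProduct]
  rw [hsum (fun s => G p s * v s) fun s h1 h2 => by simp [hv s h1 h2],
    hsum (fun s => G q s * v s) fun s h1 h2 => by simp [hv s h1 h2]]
  rfl

/-- The two orthogonal balanced states `u`, `v` on a pair of cells, written in coordinates. -/
theorem balanced_pair_relation {a b c d : ℂ} (ha : a * star a = 1 / 2) (hd : d * star d = 1 / 2)
    (h : star a * c + star b * d = 0) : star c * d = - (star a * b) := by
  have h' : a * star c + b * star d = 0 := by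
    have := congrArg star h
    simpa [mul_comm] using this
  have h1 : star a * (a * star c + b * star d) * d = 0 := by rw [h']; ring
  have h2 : (a * star a) * (star c * d) + (star a * b) * (d * star d) = 0 := by
    rw [← h1]; ring
  rw [ha, hd] at h2
  linear_combination 2 * h2

/-- Up to phases the states are `(|p⟩ ± z|q⟩) / √2`. The factor `u p * star (v p)` removes the
phases; the off-diagonal entries of `G` then contribute a number minus its conjugate, which is
imaginary. -/
theorem balanced_pair_form_re (G : Matrix κ κ ℂ) (hG : G.IsHermitian) {u v : κ → ℂ} {p q : κ}
    (hpq : p ≠ q)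
    (hu : ∀ s, s ≠ p → s ≠ q → u s = 0) (hv : ∀ s, s ≠ p → s ≠ q → v s = 0)
    (hup : u p * star (u p) = 1 / 2)
    (hvp : v p * star (v p) = 1 / 2) (hvq : v q * star (v q) = 1 / 2)
    (horth : star (u p) * v p + star (u q) * v q = 0) :
    (u p * star (v p) * (star u ⬝ᵥ (G *ᵥ v))).re = ((G p p).re - (G q q).re) / 4 := by
  have hrel := balanced_pair_relation hup hvq horth
  have hGqp : G q p = star (G p q) := (hG.apply q p).symm
  have e1 : star (u q) * v q = - (star (u p) * v p) := by linear_combination horth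
  have e2 : u p * star (v p) * (star u ⬝ᵥ (G *ᵥ v)) = (G p p - G q q) / 4 +
      (star (v p) * v q * G p q - star (star (v p) * v q * G p q)) / 2 := by
    rw [form_eq_of_support_pair G hpq hu hv, hGqp]
    have h3 : u p * star (u q) = - (v p * star (v q)) := by
      have := congrArg star hrel
      simp only [star_mul', star_neg, star_star] at this
      linear_combination this
    simp only [star_mul', star_star]
    linear_combination (G p p * (v p * star (v p)) + star (v p) * v q * G p q) * hup +
      G p p / 2 * hvp + G q q * u p * star (v p) * e1 - G q q * (v p * star (v p)) * hup
      - G q q / 2 * hvp + star (G p q) * (v p * star (v p)) * h3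
      - star (G p q) * (v p * star (v q)) * hvp
  rw [e2]
  generalize star (v p) * v q * G p q = z
  simp

theorem balanced_pair_norm_form (G : Matrix κ κ ℂ) (hG : G.IsHermitian) {u v : κ → ℂ} {p q : κ}
    (hpq : p ≠ q)
    (hu : ∀ s, s ≠ p → s ≠ q → u s = 0) (hv : ∀ s, s ≠ p → s ≠ q → v s = 0)
    (hup : u p * star (u p) = 1 / 2)
    (hvp : v p * star (v p) = 1 / 2) (hvq : v q * star (v q) = 1 / 2)
    (horth : star (u p) * v p + star (u q) * v q = 0) :
    |(G p p).re - (G q q).re| ≤ 2 * ‖star u ⬝ᵥ (G *ᵥ v)‖ := by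
  have h := balanced_pair_form_re G hG hpq hu hv hup hvp hvq horth
  have hw : ‖u p * star (v p)‖ = 1 / 2 := by
    have h1 : (‖u p‖ * ‖u p‖ : ℝ) = 1 / 2 := by simpa using congrArg norm hup
    have h2 : (‖v p‖ * ‖v p‖ : ℝ) = 1 / 2 := by simpa using congrArg norm hvp
    rw [norm_mul, norm_star]
    have h3 : (‖u p‖ * ‖v p‖) ^ 2 = (1 / 2) ^ 2 := by
      rw [mul_pow, pow_two, pow_two, h1, h2]; norm_num
    exact (pow_left_inj₀ (by positivity) (by norm_num) two_ne_zero).mp h3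
  have h4 := Complex.abs_re_le_norm (u p * star (v p) * (star u ⬝ᵥ (G *ᵥ v)))
  rw [h, norm_mul, hw, abs_div, abs_of_pos (by norm_num : (0 : ℝ) < 4)] at h4
  linarith

/-- The two states form an orthonormal basis of the span of the two cells, and a partial trace sum
does not depend on the basis. -/
theorem balanced_pair_outcomeProb (G : Matrix κ κ ℂ) {u v : EuclideanSpace ℂ κ} {p q : κ}
    (hpq : p ≠ q)
    (hu : ∀ s, s ≠ p → s ≠ q → u s = 0) (hv : ∀ s, s ≠ p → s ≠ q → v s = 0)
    (hup : u p * star (u p) = 1 / 2) (huq : u q * star (u q) = 1 / 2)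
    (hvp : v p * star (v p) = 1 / 2) (hvq : v q * star (v q) = 1 / 2)
    (horth : star (u p) * v p + star (u q) * v q = 0) :
    outcomeProb G u + outcomeProb G v = (G p p).re + (G q q).re := by
  have hrel := balanced_pair_relation hup hvq horth
  have h3 : u p * star (u q) = - (v p * star (v q)) := by
    have := congrArg star hrel
    simp only [star_mul', star_neg, star_star] at this
    linear_combination this
  rw [outcomeProb, outcomeProb, ← Complex.add_re, ← Complex.add_re,
    form_eq_of_support_pair G hpq hu hu, form_eq_of_support_pair G hpq hv hv]
  congr 1
  linear_combination G p p * hup + G p p * hvp + G q q * huq + G q q * hvq + G p q * hrel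
    + G q p * h3

end Dominoes

/-! ### Bases that induce domino tilings -/

section Tilings

open scoped ComplexOrder

variable {ι : Type*} [Fintype ι] {dA dB : ℕ}

theorem eq_pair_of_ncard_eq_two {α : Type*} {s : Set α} (hs : s.ncard = 2) {p q : α}
    (hp : p ∈ s) (hq : q ∈ s) (hpq : p ≠ q) : s = {p, q} := by
  refine (Set.eq_of_subset_of_ncard_le (Set.pair_subset hp hq) ?_
    (Set.finite_of_ncard_ne_zero (by omega))).symm
  rw [Set.ncard_pair hpq, hs]

theorem inner_eq_of_support_pair {u v : EuclideanSpace ℂ (Fin dA × Fin dB)}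
    {p q : Fin dA × Fin dB} (hpq : p ≠ q) (hu : stateSupport u ⊆ {p, q}) :
    inner ℂ u v = star (u p) * v p + star (u q) * v q := by
  rw [PiLp.inner_apply, ← Finset.sum_pair (f := fun s => star (u s) * v s) hpq]
  refine Eq.trans (b := ∑ s, star (u s) * v s)
    (Finset.sum_congr rfl fun s _ => by simp [mul_comm])
    (Finset.sum_subset (Finset.subset_univ _) fun s _ hs => ?_).symm
  by_contra h
  have : s ∈ stateSupport u := fun h0 => h (by simp [h0])
  exact hs (by simpa using hu this)

theorem inner_eq_zero_of_disjoint {u v : EuclideanSpace ℂ (Fin dA × Fin dB)}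
    (h : Disjoint (stateSupport u) (stateSupport v)) : inner ℂ u v = 0 := by
  rw [PiLp.inner_apply]
  refine Finset.sum_eq_zero fun s _ => ?_
  by_cases hu : u s = 0
  · simp [hu]
  · have : v s = 0 := by
      by_contra hv
      exact Set.disjoint_left.mp h hu hv
    simp [this]

/-- A tile of area 2 is induced by a second state of the basis. -/
theorem exists_ne_stateSupport_eq
    (ψ : OrthonormalBasis ι ℂ (EuclideanSpace ℂ (Fin dA × Fin dB)))
    (htiling : InducesTiling ψ) {i : ι} {p q : Fin dA × Fin dB} (hpq : p ≠ q)
    (hi : stateSupport (ψ i) = {p, q}) : ∃ j ≠ i, stateSupport (ψ j) = {p, q} := by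
  by_contra! hno
  -- The vector on the two cells orthogonal to `ψ i`. Without a second state on the tile it would be
  -- orthogonal to the whole basis.
  let w : EuclideanSpace ℂ (Fin dA × Fin dB) :=
    WithLp.toLp 2 (Pi.single p (star (ψ i q)) - Pi.single q (star (ψ i p)))
  have hwp : w p = star (ψ i q) := by simp [w, hpq]
  have hwq : w q = - star (ψ i p) := by simp [w, hpq.symm]
  have hws : stateSupport w ⊆ {p, q} := by
    intro s hs
    by_contra hn
    simp only [Set.mem_insert_iff, Set.mem_singleton_iff, not_or] at hn
    exact hs (by simp [w, hn.1, hn.2])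
  have horth : ∀ j, inner ℂ (ψ j) w = 0 := by
    intro j
    by_cases hj : j = i
    · rw [hj, inner_eq_of_support_pair hpq hi.subset, hwp, hwq]
      ring
    · refine inner_eq_zero_of_disjoint (Set.disjoint_of_subset_right hws ?_)
      rcases htiling j i with h | h
      · exact absurd (h.trans hi) (hno j hj)
      · rwa [hi] at h
  have hw0 : w = 0 := by
    rw [← ψ.sum_repr' w]
    exact Finset.sum_eq_zero fun j _ => by rw [horth j, zero_smul]
  have hq : q ∈ stateSupport (ψ i) := by rw [hi]; simp
  apply hq
  have := hwp.symm
  rw [hw0] at this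
  simpa using this

theorem mul_star_eq_half {u : EuclideanSpace ℂ (Fin dA × Fin dB)} (hu1 : ‖u‖ = 1)
    (hbal : IsBalanced u) {p q : Fin dA × Fin dB} (hpq : p ≠ q) (hu : stateSupport u = {p, q}) :
    u p * star (u p) = 1 / 2 ∧ u q * star (u q) = 1 / 2 := by
  have h1 : inner ℂ u u = (1 : ℂ) := by rw [inner_self_eq_norm_sq_to_K, hu1]; simp
  rw [inner_eq_of_support_pair hpq hu.subset] at h1
  have h2 : ‖u p‖ = ‖u q‖ := hbal p (by rw [hu]; simp) q (by rw [hu]; simp)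
  have h3 : ∀ z : ℂ, z * star z = (‖z‖ : ℂ) ^ 2 := fun z => Complex.mul_conj' z
  rw [mul_comm, mul_comm (star (u q)), h3, h3, h2] at h1
  rw [h3, h3, h2]
  constructor <;> linear_combination h1 / 2

/-- The two states of a tile `{p, q}` of area 2. -/
theorem exists_domino_partner
    (ψ : OrthonormalBasis ι ℂ (EuclideanSpace ℂ (Fin dA × Fin dB)))
    (htiling : InducesTiling ψ) (hbalanced : ∀ i, IsBalanced (ψ i)) {i : ι}
    {p q : Fin dA × Fin dB} (hpq : p ≠ q) (hi : stateSupport (ψ i) = {p, q}) :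
    ∃ j, i ≠ j ∧ ∀ G : Matrix (Fin dA × Fin dB) (Fin dA × Fin dB) ℂ, G.IsHermitian →
      |(G p p).re - (G q q).re| ≤ 2 * ‖star (ψ i : Fin dA × Fin dB → ℂ) ⬝ᵥ (G *ᵥ (ψ j))‖ ∧
      outcomeProb G (ψ i) + outcomeProb G (ψ j) = (G p p).re + (G q q).re := by
  obtain ⟨j, hji, hj⟩ := exists_ne_stateSupport_eq ψ htiling hpq hi
  have hoff : ∀ k, stateSupport (ψ k) = {p, q} → ∀ s, s ≠ p → s ≠ q → ψ k s = 0 := by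
    intro k hk s h1 h2
    by_contra h
    have : s ∈ stateSupport (ψ k) := h
    rw [hk] at this
    simp_all
  obtain ⟨hup, huq⟩ := mul_star_eq_half (ψ.orthonormal.1 i) (hbalanced i) hpq hi
  obtain ⟨hvp, hvq⟩ := mul_star_eq_half (ψ.orthonormal.1 j) (hbalanced j) hpq hj
  have horth : star (ψ i p) * ψ j p + star (ψ i q) * ψ j q = 0 := by
    rw [← inner_eq_of_support_pair hpq hi.subset]
    exact ψ.orthonormal.2 hji.symm
  refine ⟨j, hji.symm, fun G hG => ⟨?_, ?_⟩⟩
  · exact balanced_pair_norm_form G hG hpq (hoff i hi) (hoff j hj) hup hvp hvq horth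
  · exact balanced_pair_outcomeProb G hpq (hoff i hi) (hoff j hj) hup huq hvp hvq horth

theorem outcomeProb_of_support_singleton {u : EuclideanSpace ℂ (Fin dA × Fin dB)}
    (hu1 : ‖u‖ = 1) {p : Fin dA × Fin dB} (hu : stateSupport u = {p})
    (G : Matrix (Fin dA × Fin dB) (Fin dA × Fin dB) ℂ) : outcomeProb G u = (G p p).re := by
  have h0 : ∀ s, s ≠ p → u s = 0 := by
    intro s hs
    by_contra h
    have : s ∈ stateSupport u := h
    rw [hu] at this
    exact hs this
  have h1 : star (u p) * u p = 1 := by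
    have h1 : inner ℂ u u = (1 : ℂ) := by rw [inner_self_eq_norm_sq_to_K, hu1]; simp
    rw [PiLp.inner_apply, Finset.sum_eq_single p (fun s _ hs => by simp [h0 s hs])
      (by simp)] at h1
    rw [← h1, RCLike.inner_apply, mul_comm]
    rfl
  rw [outcomeProb, dotProduct, Finset.sum_eq_single p (fun s _ hs => by simp [h0 s hs]) (by simp),
    Matrix.mulVec, dotProduct, Finset.sum_eq_single p (fun s _ hs => by simp [h0 s hs]) (by simp)]
  congr 1
  simp only [Pi.star_apply]
  linear_combination G p p * h1

/-- A state of a domino-type basis has at most the probability of two cells. -/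
theorem outcomeProb_le_two_mul
    (ψ : OrthonormalBasis ι ℂ (EuclideanSpace ℂ (Fin dA × Fin dB)))
    (htiling : InducesTiling ψ) (hdomino : IsDominoType (inducedTiles ψ))
    (hbalanced : ∀ i, IsBalanced (ψ i))
    {G : Matrix (Fin dA × Fin dB) (Fin dA × Fin dB) ℂ} (hG : G.PosSemidef) {m : ℝ}
    (hm : ∀ p, (G p p).re ≤ m) (i : ι) : outcomeProb G (ψ i) ≤ 2 * m := by
  rcases hdomino _ ⟨i, rfl⟩ with h | h
  · obtain ⟨p, hp⟩ := Set.ncard_eq_one.mp h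
    have h1 := outcomeProb_of_support_singleton (ψ.orthonormal.1 i) hp G
    have h2 := hG.outcomeProb_nonneg (ψ i)
    linarith [hm p]
  · obtain ⟨p, q, hpq, hp⟩ := Set.ncard_eq_two.mp h
    obtain ⟨j, _, hj⟩ := exists_domino_partner ψ htiling hbalanced hpq hp
    -- The partner's probability is nonnegative and can be dropped from the sum over the domino.
    linarith [(hj G hG.1).2, hm p, hm q, hG.outcomeProb_nonneg (ψ j)]

end Tilings

/-! ### Operators accumulated along a protocol -/

section Protocols

open scoped ComplexOrder

variable {ι : Type*} [DecidableEq ι] {dA dB : ℕ}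

theorem LOCCProtocol.elementFrom_posSemidef {a b : ℕ} (P : LOCCProtocol ι a b)
    (A : Matrix (Fin a) (Fin dA) ℂ) (B : Matrix (Fin b) (Fin dB) ℂ) (j : ι) :
    (P.elementFrom A B j).PosSemidef := by
  induction P with
  | leaf out =>
    rw [elementFrom]
    split_ifs
    · exact (Matrix.posSemidef_conjTranspose_mul_self A).kronecker
        (Matrix.posSemidef_conjTranspose_mul_self B)
    · exact Matrix.PosSemidef.zero
  | alice k m M _ next ih => exact Matrix.posSemidef_sum _ fun i _ => ih i _ _
  | bob k m M _ next ih => exact Matrix.posSemidef_sum _ fun i _ => ih i _ _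

theorem sum_conjTranspose_mul_mul {k m a d : ℕ} {M : Fin k → Matrix (Fin m) (Fin a) ℂ}
    (hM : ∑ i, (M i)ᴴ * M i = 1) (A : Matrix (Fin a) (Fin d) ℂ) :
    ∑ i, (M i * A)ᴴ * (M i * A) = Aᴴ * A := by
  calc ∑ i, (M i * A)ᴴ * (M i * A) = Aᴴ * (∑ i, (M i)ᴴ * M i) * A := by
        rw [Matrix.mul_sum, Matrix.sum_mul]
        refine Finset.sum_congr rfl fun i _ => ?_
        rw [Matrix.conjTranspose_mul]
        simp only [Matrix.mul_assoc]
    _ = Aᴴ * A := by rw [hM, Matrix.mul_one]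

theorem LOCCProtocol.sum_elementFrom [Fintype ι] {a b : ℕ} (P : LOCCProtocol ι a b)
    (A : Matrix (Fin a) (Fin dA) ℂ) (B : Matrix (Fin b) (Fin dB) ℂ) :
    ∑ j, P.elementFrom A B j = (Aᴴ * A) ⊗ₖ (Bᴴ * B) := by
  induction P with
  | leaf out => simp [elementFrom]
  | alice k m M hM next ih =>
    simp only [elementFrom]
    rw [Finset.sum_comm, ← sum_conjTranspose_mul_mul hM A]
    simp only [ih]
    ext p q
    simp [Matrix.sum_apply, Finset.sum_mul, Matrix.kroneckerMap_apply]
  | bob k m M hM next ih =>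
    simp only [elementFrom]
    rw [Finset.sum_comm, ← sum_conjTranspose_mul_mul hM B]
    simp only [ih]
    ext p q
    simp [Matrix.sum_apply, Finset.mul_sum, Matrix.kroneckerMap_apply]

end Protocols

/-! ### The nearly uniform region and induction on the protocol -/

section Region

open scoped ComplexOrder

variable {ι : Type*} [Fintype ι] [DecidableEq ι] {dA dB : ℕ}

/-- The trace of `a ⊗ b`, through the diagonals of `a` and `b`. -/
noncomputable def productWeight (a : Matrix (Fin dA) (Fin dA) ℂ) (b : Matrix (Fin dB) (Fin dB) ℂ) :
    ℝ :=
  (∑ r, (a r r).re) * ∑ c, (b c c).re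

/-- The amount by which the weight of a cell exceeds `1 / n + 1 / (2 n²)` of the total weight. -/
noncomputable def cellExcess (n : ℝ) (a : Matrix (Fin dA) (Fin dA) ℂ)
    (b : Matrix (Fin dB) (Fin dB) ℂ) (q : Fin dA × Fin dB) : ℝ :=
  (a q.1 q.1).re * (b q.2 q.2).re - (1 / n + 1 / (2 * n ^ 2)) * productWeight a b

theorem productWeight_mix_left (s t : ℝ) (a a' : Matrix (Fin dA) (Fin dA) ℂ)
    (b : Matrix (Fin dB) (Fin dB) ℂ) :
    productWeight (s • a + t • a') b = s * productWeight a b + t * productWeight a' b := by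
  simp only [productWeight, Matrix.add_apply, Matrix.smul_apply, Complex.add_re, Complex.smul_re,
    smul_eq_mul, Finset.sum_add_distrib, ← Finset.mul_sum]
  ring

theorem productWeight_mix_right (s t : ℝ) (a : Matrix (Fin dA) (Fin dA) ℂ)
    (b b' : Matrix (Fin dB) (Fin dB) ℂ) :
    productWeight a (s • b + t • b') = s * productWeight a b + t * productWeight a b' := by
  simp only [productWeight, Matrix.add_apply, Matrix.smul_apply, Complex.add_re, Complex.smul_re,
    smul_eq_mul, Finset.sum_add_distrib, ← Finset.mul_sum]
  ring

/-- Measuring the excess against the unnormalised weight makes it linear in each factor, as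
`exists_crossing` requires. -/
theorem cellExcess_mix_left (n s t : ℝ) (a a' : Matrix (Fin dA) (Fin dA) ℂ)
    (b : Matrix (Fin dB) (Fin dB) ℂ) (q : Fin dA × Fin dB) :
    cellExcess n (s • a + t • a') b q = s * cellExcess n a b q + t * cellExcess n a' b q := by
  simp only [cellExcess, productWeight_mix_left, Matrix.add_apply, Matrix.smul_apply,
    Complex.add_re, Complex.smul_re, smul_eq_mul]
  ring

theorem cellExcess_mix_right (n s t : ℝ) (a : Matrix (Fin dA) (Fin dA) ℂ)
    (b b' : Matrix (Fin dB) (Fin dB) ℂ) (q : Fin dA × Fin dB) :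
    cellExcess n a (s • b + t • b') q = s * cellExcess n a b q + t * cellExcess n a b' q := by
  simp only [cellExcess, productWeight_mix_right, Matrix.add_apply, Matrix.smul_apply,
    Complex.add_re, Complex.smul_re, smul_eq_mul]
  ring

theorem productWeight_sum_left {α : Type*} [Fintype α] (a : α → Matrix (Fin dA) (Fin dA) ℂ)
    (b : Matrix (Fin dB) (Fin dB) ℂ) :
    productWeight (∑ i, a i) b = ∑ i, productWeight (a i) b := by
  simp only [productWeight, Matrix.sum_apply, Complex.re_sum, ← Finset.sum_mul]
  rw [Finset.sum_comm]

theorem productWeight_sum_right {α : Type*} [Fintype α] (a : Matrix (Fin dA) (Fin dA) ℂ)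
    (b : α → Matrix (Fin dB) (Fin dB) ℂ) :
    productWeight a (∑ i, b i) = ∑ i, productWeight a (b i) := by
  simp only [productWeight, Matrix.sum_apply, Complex.re_sum, ← Finset.mul_sum]
  rw [Finset.sum_comm]

theorem Matrix.PosSemidef.diag_re_nonneg {m : Type*} [Fintype m] {a : Matrix m m ℂ}
    (ha : a.PosSemidef) (i : m) : 0 ≤ (a i i).re :=
  (Complex.nonneg_iff.mp ha.diag_nonneg).1

theorem productWeight_nonneg {a : Matrix (Fin dA) (Fin dA) ℂ} {b : Matrix (Fin dB) (Fin dB) ℂ}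
    (ha : a.PosSemidef) (hb : b.PosSemidef) : 0 ≤ productWeight a b :=
  mul_nonneg (Finset.sum_nonneg fun i _ => ha.diag_re_nonneg i)
    (Finset.sum_nonneg fun i _ => hb.diag_re_nonneg i)

theorem kronecker_diag_re {a : Matrix (Fin dA) (Fin dA) ℂ} {b : Matrix (Fin dB) (Fin dB) ℂ}
    (ha : a.PosSemidef) (q : Fin dA × Fin dB) :
    ((a ⊗ₖ b) q q).re = (a q.1 q.1).re * (b q.2 q.2).re := by
  rw [Matrix.kroneckerMap_apply, Complex.mul_re,
    ← (Complex.nonneg_iff.mp (ha.diag_nonneg (i := q.1))).2]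
  simp

theorem productWeight_eq_trace {a : Matrix (Fin dA) (Fin dA) ℂ} {b : Matrix (Fin dB) (Fin dB) ℂ}
    (ha : a.PosSemidef) : productWeight a b = ((a ⊗ₖ b).trace).re := by
  rw [Matrix.trace, Complex.re_sum]
  simp only [Matrix.diag_apply, kronecker_diag_re ha]
  rw [productWeight, Finset.sum_mul_sum, Fintype.sum_prod_type]

/-- Interpolating between a parent and a child replaces any decomposition into weak measurements:
the boundary bound holds for every refining measurement, so the interpolant need not come from a
protocol. -/
theorem LOCCProtocol.le_totalError_elementFrom (ψ : ι → EuclideanSpace ℂ (Fin dA × Fin dB))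
    {n φ : ℝ}
    (hleaf : ∀ (a : Matrix (Fin dA) (Fin dA) ℂ) (b : Matrix (Fin dB) (Fin dB) ℂ) (out : ι),
      a.PosSemidef → b.PosSemidef → (∀ q, cellExcess n a b q ≤ 0) →
      φ * productWeight a b ≤ totalError ψ fun j => if out = j then a ⊗ₖ b else 0)
    (hboundary : ∀ (a : Matrix (Fin dA) (Fin dA) ℂ) (b : Matrix (Fin dB) (Fin dB) ℂ)
      (E : ι → Matrix (Fin dA × Fin dB) (Fin dA × Fin dB) ℂ),
      a.PosSemidef → b.PosSemidef → (∀ j, (E j).PosSemidef) → ∑ j, E j = a ⊗ₖ b →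
      (∀ q, cellExcess n a b q ≤ 0) → (∃ q, cellExcess n a b q = 0) →
      φ * productWeight a b ≤ totalError ψ E)
    {a b : ℕ} (P : LOCCProtocol ι a b) (A : Matrix (Fin a) (Fin dA) ℂ)
    (B : Matrix (Fin b) (Fin dB) ℂ) (hregion : ∀ q, cellExcess n (Aᴴ * A) (Bᴴ * B) q ≤ 0) :
    φ * productWeight (Aᴴ * A) (Bᴴ * B) ≤ totalError ψ (P.elementFrom A B) := by
  have hsq : ∀ {m d : ℕ} (A : Matrix (Fin m) (Fin d) ℂ), (Aᴴ * A).PosSemidef :=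
    fun A => Matrix.posSemidef_conjTranspose_mul_self A
  have hmix : ∀ {κ : Type} [Fintype κ] {E F : Matrix κ κ ℂ} {t : ℝ}, 0 ≤ t → t ≤ 1 →
      E.PosSemidef → F.PosSemidef → ((1 - t) • E + t • F).PosSemidef := by
    intro κ _ E F t h0 h1 hE hF
    have := (hE.smul (a := 1 - t) (by linarith)).add (hF.smul (a := t) h0)
    exact this
  -- If the parent violates the bound and a mixture obeys it, the child obeys it. At `t = 0` the
  -- mixture is the parent itself, a contradiction.
  have hconclude : ∀ {e e' w w' t : ℝ}, 0 ≤ t → t ≤ 1 → e < φ * w →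
      φ * ((1 - t) * w + t * w') ≤ (1 - t) * e + t * e' → φ * w' ≤ e' := by
    intro e e' w w' t h0 h1 he h
    rcases h0.eq_or_lt with rfl | h0
    · linarith
    · refine le_of_mul_le_mul_left ?_ h0
      nlinarith [mul_le_mul_of_nonneg_left he.le (sub_nonneg.mpr h1)]
  induction P with
  | leaf out => exact hleaf _ _ out (hsq A) (hsq B) hregion
  | @alice a b k m M hM next ih =>
    by_contra! hlt
    have hchild : ∀ i, φ * productWeight ((M i * A)ᴴ * (M i * A)) (Bᴴ * B) ≤
        totalError ψ ((next i).elementFrom (M i * A) B) := by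
      intro i
      by_cases hreg : ∀ q, cellExcess n ((M i * A)ᴴ * (M i * A)) (Bᴴ * B) q ≤ 0
      · exact ih i _ _ hreg
      push Not at hreg
      -- Bob's factor is common to parent and child, so the boundary point on the segment is again a
      -- product operator.
      obtain ⟨t, h0, h1, hle, heq⟩ := exists_crossing hregion hreg
      simp only [← cellExcess_mix_left] at hle heq
      refine hconclude h0 h1 hlt ?_
      rw [← productWeight_mix_left, ← totalError_smul, ← totalError_smul, ← totalError_add]
      refine hboundary _ _ _ (hmix h0 h1 (hsq A) (hsq _)) (hsq B) (fun j => hmix h0 h1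
        (elementFrom_posSemidef _ _ _ _) (elementFrom_posSemidef _ _ _ _)) ?_ hle heq
      simp only [Pi.add_apply, Pi.smul_apply]
      rw [Finset.sum_add_distrib, ← Finset.smul_sum, ← Finset.smul_sum, sum_elementFrom,
        sum_elementFrom, Matrix.add_kronecker, Matrix.smul_kronecker, Matrix.smul_kronecker]
    have hsum : totalError ψ ((alice k m M hM next).elementFrom A B) =
        ∑ i, totalError ψ ((next i).elementFrom (M i * A) B) :=
      totalError_sum _ _ _
    rw [hsum, ← sum_conjTranspose_mul_mul hM A, productWeight_sum_left, Finset.mul_sum] at hlt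
    exact absurd (Finset.sum_le_sum fun i _ => hchild i) (not_le.mpr hlt)
  | @bob a b k m M hM next ih =>
    by_contra! hlt
    have hchild : ∀ i, φ * productWeight (Aᴴ * A) ((M i * B)ᴴ * (M i * B)) ≤
        totalError ψ ((next i).elementFrom A (M i * B)) := by
      intro i
      by_cases hreg : ∀ q, cellExcess n (Aᴴ * A) ((M i * B)ᴴ * (M i * B)) q ≤ 0
      · exact ih i _ _ hreg
      push Not at hreg
      obtain ⟨t, h0, h1, hle, heq⟩ := exists_crossing hregion hreg
      simp only [← cellExcess_mix_right] at hle heq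
      refine hconclude h0 h1 hlt ?_
      rw [← productWeight_mix_right, ← totalError_smul, ← totalError_smul, ← totalError_add]
      refine hboundary _ _ _ (hsq A) (hmix h0 h1 (hsq B) (hsq _)) (fun j => hmix h0 h1
        (elementFrom_posSemidef _ _ _ _) (elementFrom_posSemidef _ _ _ _)) ?_ hle heq
      simp only [Pi.add_apply, Pi.smul_apply]
      rw [Finset.sum_add_distrib, ← Finset.smul_sum, ← Finset.smul_sum, sum_elementFrom,
        sum_elementFrom, Matrix.kronecker_add, Matrix.kronecker_smul, Matrix.kronecker_smul]
    have hsum : totalError ψ ((bob k m M hM next).elementFrom A B) =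
        ∑ i, totalError ψ ((next i).elementFrom A (M i * B)) :=
      totalError_sum _ _ _
    rw [hsum, ← sum_conjTranspose_mul_mul hM B, productWeight_sum_right, Finset.mul_sum] at hlt
    exact absurd (Finset.sum_le_sum fun i _ => hchild i) (not_le.mpr hlt)

/-! ### Error bounds on the boundary and at the leaves -/

/-- If a measurement that refines `G` errs rarely, the diagonal of `G` varies little on a tile. -/
theorem abs_diag_sub_le_of_totalError_lt
    (ψ : OrthonormalBasis ι ℂ (EuclideanSpace ℂ (Fin dA × Fin dB)))
    (htiling : InducesTiling ψ) (hdomino : IsDominoType (inducedTiles ψ))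
    (hbalanced : ∀ i, IsBalanced (ψ i))
    {G : Matrix (Fin dA × Fin dB) (Fin dA × Fin dB) ℂ} (hG : G.PosSemidef)
    {E : ι → Matrix (Fin dA × Fin dB) (Fin dA × Fin dB) ℂ} (hE : ∀ j, (E j).PosSemidef)
    (hEG : ∑ j, E j = G) {D n T : ℝ} (hD : 0 < D) (hn : 9 ≤ n) (hT : 0 < T)
    (hle : ∀ p, (G p p).re ≤ (1 / n + 1 / (2 * n ^ 2)) * T)
    (herr : totalError ψ E < 1 / (216 * D ^ 2 * n ^ 5) * T)
    {t : Set (Fin dA × Fin dB)} (ht : t ∈ inducedTiles ψ) {p q : Fin dA × Fin dB} (hpq : p ≠ q)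
    (hp : p ∈ t) (hq : q ∈ t) :
    |(G p p).re - (G q q).re| ≤ 2 * (1 / (10 * D * n ^ 3)) * T := by
  have hn0 : 0 < n := by linarith
  obtain ⟨i, rfl⟩ := ht
  have h2 : (stateSupport (ψ i)).ncard = 2 := by
    rcases hdomino _ ⟨i, rfl⟩ with h | h
    · obtain ⟨s, hs⟩ := Set.ncard_eq_one.mp h
      simp only [hs, Set.mem_singleton_iff] at hp hq
      exact absurd (hp.trans hq.symm) hpq
    · exact h
  obtain ⟨j, hij, hj⟩ := exists_domino_partner ψ htiling hbalanced hpq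
    (eq_pair_of_ncard_eq_two h2 hp hq hpq)
  obtain ⟨hdiff, hprob⟩ := hj G hG.1
  have hconf := norm_form_sq_le_totalError ψ hE hEG hij
  rw [hprob] at hconf
  -- For `n ≥ 9`, `1 / (2n²) ≤ 1 / (18n)`. The constant 216 is chosen so that `2 * (19/18) / 216 =
  -- 19/1944` stays below `1/100`, the square of the `1/10` in the conclusion.
  have hle' : (1 / n + 1 / (2 * n ^ 2)) ≤ 19 / (18 * n) := by
    have : 19 / (18 * n) - (1 / n + 1 / (2 * n ^ 2)) = (n - 9) / (18 * n ^ 2) := by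
      field_simp; ring
    have : 0 ≤ (n - 9) / (18 * n ^ 2) := div_nonneg (by linarith) (by positivity)
    linarith
  have hcells : (G p p).re + (G q q).re ≤ 2 * (19 / (18 * n) * T) := by
    linarith [hle p, hle q, mul_le_mul_of_nonneg_right hle' hT.le]
  have hsq : ‖star (ψ i : Fin dA × Fin dB → ℂ) ⬝ᵥ (G *ᵥ (ψ j))‖ ^ 2 ≤
      (1 / (10 * D * n ^ 3) * T) ^ 2 := by
    calc _ ≤ _ := hconf
      _ ≤ 2 * (19 / (18 * n) * T) * (1 / (216 * D ^ 2 * n ^ 5) * T) :=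
        mul_le_mul hcells herr.le (totalError_nonneg ψ hE) (by positivity)
      _ = 19 / 1944 * (T ^ 2 / (D ^ 2 * n ^ 6)) := by field_simp; norm_num
      _ ≤ 1 / 100 * (T ^ 2 / (D ^ 2 * n ^ 6)) :=
        mul_le_mul_of_nonneg_right (by norm_num) (by positivity)
      _ = _ := by field_simp; norm_num
  have := (pow_le_pow_iff_left₀ (norm_nonneg _) (by positivity) two_ne_zero).mp hsq
  linarith

/-- A smaller error would make the diagonal almost constant on every domino; `grid_cell_lt` would
then put every cell strictly below the threshold that one of them attains. -/
theorem le_totalError_of_boundary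
    (ψ : OrthonormalBasis ι ℂ (EuclideanSpace ℂ (Fin dA × Fin dB)))
    (htiling : InducesTiling ψ) (hdomino : IsDominoType (inducedTiles ψ))
    (hbalanced : ∀ i, IsBalanced (ψ i)) (hirred : IsIrreducibleTiling (inducedTiles ψ))
    {D : ℕ} (hD0 : 0 < D) (hD : tilingDiameter (inducedTiles ψ) ≤ D)
    {n : ℝ} (hn : n = dA * dB) (hn9 : 9 ≤ n)
    {a : Matrix (Fin dA) (Fin dA) ℂ} {b : Matrix (Fin dB) (Fin dB) ℂ}
    {E : ι → Matrix (Fin dA × Fin dB) (Fin dA × Fin dB) ℂ}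
    (ha : a.PosSemidef) (hb : b.PosSemidef) (hE : ∀ j, (E j).PosSemidef)
    (hEG : ∑ j, E j = a ⊗ₖ b)
    (hle : ∀ q, cellExcess n a b q ≤ 0) (heq : ∃ q, cellExcess n a b q = 0) :
    1 / (216 * (D : ℝ) ^ 2 * n ^ 5) * productWeight a b ≤ totalError ψ E := by
  rcases (productWeight_nonneg ha hb).eq_or_lt with hT | hT
  · rw [← hT, mul_zero]
    exact totalError_nonneg ψ hE
  by_contra! hlt
  have hG : (a ⊗ₖ b).PosSemidef := ha.kronecker hb
  have hdiff := fun t ht p q => abs_diag_sub_le_of_totalError_lt ψ htiling hdomino hbalanced hG hE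
    hEG (Nat.cast_pos.mpr hD0) hn9 hT
    (fun p => by rw [kronecker_diag_re ha]; exact sub_nonpos.mp (hle p)) hlt (t := t) ht
    (p := p) (q := q)
  simp only [kronecker_diag_re ha] at hdiff
  obtain ⟨⟨r, c⟩, hrc⟩ := heq
  refine (grid_cell_lt (fun r => ha.diag_re_nonneg r) (fun c => hb.diag_re_nonneg c)
    hirred.1 hirred.2 hD0 ((le_max_left _ _).trans hD) ((le_max_right _ _).trans hD)
    (by simpa using hn) hn9 rfl hT (fun r c => sub_nonpos.mp (hle (r, c))) ?_ ?_ r c).ne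
    (sub_eq_zero.mp hrc)
  · rintro c c' ⟨hne, t, ht, r, h1, h2⟩
    refine ⟨r, ?_⟩
    have := hdiff t ht (r, c) (r, c') (by simpa using hne) h1 h2
    rwa [← mul_sub, abs_mul, abs_of_nonneg (ha.diag_re_nonneg r)] at this
  · rintro r r' ⟨hne, t, ht, c, h1, h2⟩
    refine ⟨c, ?_⟩
    have := hdiff t ht (r, c) (r', c) (by simpa using hne) h1 h2
    rwa [← sub_mul, abs_mul, abs_of_nonneg (hb.diag_re_nonneg c), mul_comm] at this

theorem le_totalError_single
    (ψ : OrthonormalBasis ι ℂ (EuclideanSpace ℂ (Fin dA × Fin dB)))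
    (htiling : InducesTiling ψ) (hdomino : IsDominoType (inducedTiles ψ))
    (hbalanced : ∀ i, IsBalanced (ψ i))
    {D : ℕ} (hD0 : 0 < D) {n : ℝ} (hn9 : 9 ≤ n)
    {a : Matrix (Fin dA) (Fin dA) ℂ} {b : Matrix (Fin dB) (Fin dB) ℂ}
    (ha : a.PosSemidef) (hb : b.PosSemidef) (hle : ∀ q, cellExcess n a b q ≤ 0) (out : ι) :
    1 / (216 * (D : ℝ) ^ 2 * n ^ 5) * productWeight a b ≤
      totalError ψ fun j => if out = j then a ⊗ₖ b else 0 := by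
  have hT := productWeight_nonneg ha hb
  have hout := outcomeProb_le_two_mul ψ htiling hdomino hbalanced (ha.kronecker hb)
    (fun p => by rw [kronecker_diag_re ha]; exact sub_nonpos.mp (hle p)) out
  rw [totalError_single, sum_outcomeProb, ← productWeight_eq_trace ha]
  have hD1 : (1 : ℝ) ≤ D := by exact_mod_cast hD0
  have h1 : 1 / (216 * (D : ℝ) ^ 2 * n ^ 5) ≤ 1 / 216 := by
    refine one_div_le_one_div_of_le (by norm_num) ?_
    nlinarith [one_le_pow₀ (n := 2) hD1, one_le_pow₀ (n := 5) (by linarith : (1 : ℝ) ≤ n),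
      mul_le_mul (one_le_pow₀ (n := 2) hD1) (one_le_pow₀ (n := 5) (by linarith : (1 : ℝ) ≤ n))
        zero_le_one (by positivity)]
  have h2 : 1 / n + 1 / (2 * n ^ 2) ≤ 1 / 9 + 1 / (2 * 9 ^ 2) := by gcongr
  -- The announced state receives at most `2 * (1/9 + 1/162) = 19/81` of the weight; the remaining
  -- `62/81` is error.
  nlinarith [mul_le_mul_of_nonneg_right h1 hT, mul_le_mul_of_nonneg_right h2 hT]

/-- Keeps the divisions by `D` meaningful. -/
theorem tilingDiameter_pos {T : Set (Set (Fin dA × Fin dB))} (hT : IsIrreducibleTiling T)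
    (hdA : 2 ≤ dA) : 0 < tilingDiameter T := by
  have hconn := hT.1
  have := hconn.nonempty
  have h : (rowGraph T).dist ⟨0, by omega⟩ ⟨1, by omega⟩ ≤ (rowGraph T).diam :=
    SimpleGraph.dist_le_diam (SimpleGraph.connected_iff_ediam_ne_top.mp hconn)
  have h' : 0 < (rowGraph T).dist ⟨0, by omega⟩ ⟨1, by omega⟩ :=
    hconn.pos_dist_of_ne (by simp)
  exact (h'.trans_le h).trans_le (le_max_left _ _)

end Region

/-! ### The error bound for LOCC -/

theorem mainTheorem4 {ι : Type*} [Fintype ι] [DecidableEq ι] (dA dB : ℕ)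
    (hdA : 3 ≤ dA) (hdB : 3 ≤ dB)
    (ψ : OrthonormalBasis ι ℂ (EuclideanSpace ℂ (Fin dA × Fin dB)))
    (hprod : ∀ i, IsProductState (ψ i))
    (htiling : InducesTiling ψ)
    (hdomino : IsDominoType (inducedTiles ψ))
    (hbalanced : ∀ i, IsBalanced (ψ i))
    (hirred : IsIrreducibleTiling (inducedTiles ψ))
    (D : ℕ) (hD : tilingDiameter (inducedTiles ψ) = D)
    (P : LOCCProtocol ι dA dB) :
    1 / (216 * (D : ℝ) ^ 2 * ((dA : ℝ) * (dB : ℝ)) ^ 5) ≤ errorProb ψ P.povm := by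
  have hD0 : 0 < D := hD ▸ tilingDiameter_pos hirred (by omega)
  obtain ⟨n, hn⟩ : ∃ n : ℝ, n = dA * dB := ⟨_, rfl⟩
  have hn9 : 9 ≤ n := by
    have h1 : (3 : ℝ) ≤ dA := by exact_mod_cast hdA
    have h2 : (3 : ℝ) ≤ dB := by exact_mod_cast hdB
    rw [hn]; nlinarith
  have hcard : (Fintype.card ι : ℝ) = n := by
    have h := Module.finrank_eq_card_basis ψ.toBasis
    rw [finrank_euclideanSpace, Fintype.card_prod, Fintype.card_fin, Fintype.card_fin] at h
    rw [← h, hn]; push_cast; rfl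
  have hW : productWeight ((1 : Matrix (Fin dA) (Fin dA) ℂ)ᴴ * 1)
      ((1 : Matrix (Fin dB) (Fin dB) ℂ)ᴴ * 1) = n := by
    simp [productWeight, hn]
  -- At the root every cell is 1 and the threshold is `1 + 1 / (2n)`. The root weight `n` later
  -- cancels the uniform prior `1 / n`.
  have h := P.le_totalError_elementFrom ψ (n := n) (φ := 1 / (216 * (D : ℝ) ^ 2 * n ^ 5))
    (fun a b out ha hb hle => le_totalError_single ψ htiling hdomino hbalanced hD0 hn9 ha hb hle out)
    (fun a b E ha hb hE hEG hle heq => le_totalError_of_boundary ψ htiling hdomino hbalanced hirred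
      hD0 hD.le hn hn9 ha hb hE hEG hle heq) 1 1 (fun q => by
        rw [cellExcess, hW]
        have : (1 / n + 1 / (2 * n ^ 2)) * n = 1 + 1 / (2 * n) := by field_simp
        have : 0 < 1 / (2 * n) := by positivity
        simp only [Matrix.conjTranspose_one, mul_one, Matrix.one_apply_eq, Complex.one_re]
        linarith)
  rw [hW] at h
  rw [errorProb_eq_totalError, hcard, ← hn]
  have hn0 : 0 < n := by linarith
  calc 1 / (216 * (D : ℝ) ^ 2 * n ^ 5) = 1 / n * (1 / (216 * (D : ℝ) ^ 2 * n ^ 5) * n) := by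
        field_simp
    _ ≤ 1 / n * totalError ψ P.povm := mul_le_mul_of_nonneg_left h (by positivity)
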